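/- Let $X, Y$ be real Hilbert spaces, $f : X \to \mathbb{R}$ a continuously differentiable convex function whose gradient $\nabla f$ is $\ell$-Lipschitz continuous, $A : X \to Y$ a continuous linear operator with adjoint $A^*$, and $b \in Y$. Let $$\mathcal{L}(x,\lambda) = f(x) + \langle \lambda, Ax - b\rangle, \qquad \mathcal{L}_\beta(x,\lambda) = \mathcal{L}(x,\lambda) + \frac{\beta}{2}\|Ax-b\|^2$$ be the Lagrangian and the augmented Lagrangian of the problem of minimizing $f(x)$ subject to $Ax = b$. Let $t_0 > 0$, $\alpha > 3$, $\beta \ge 0$ and $\frac{1}{\alpha-1} < \theta < \frac12$. Let $(x,\lambda) : [t_0,+\infty) \to X \times Y$ be a twice continuously differentiable solution of the system $$\ddot x(t) + \frac{\alpha}{t}\dot x(t) + \nabla_x \mathcal{L}_\beta\big(x(t), \lambda(t) + \theta t \dot\lambda(t)\big) = 0,$$ $$\ddot \lambda(t) + \frac{\alpha}{t}\dot \lambda(t) - \nabla_\lambda \mathcal{L}_\beta\big(x(t) + \theta t \dot x(t), \lambda(t)\big) = 0 \qquad (t \ge t_0)$$ with arbitrary initial data $(x(t_0),\lambda(t_0))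 = (x_0,\lambda_0)$ and $(\dot x(t_0),\dot\lambda(t_0)) = (\dot x_0,\dot\lambda_0)$ in $X\times Y$, and let $(x_*,\lambda_*)$ be a saddle point of $\mathcal{L}$, that is, $\mathcal{L}(x_*,\lambda) \le \mathcal{L}(x_*,\lambda_*) \le \mathcal{L}(x,\lambda_*)$ for all $(x,\lambda) \in X \times Y$. Then, as $t \to +\infty$, $$\|A^*(\lambda(t) - \lambda_*)\| = o\Big(\frac{1}{\sqrt t}\Big) \quad\text{and}\quad \|\nabla f(x(t)) - \nabla f(x_*)\| = o\Big(\frac{1}{\sqrt t}\Big).$$ Consequently, $$\|\nabla_x \mathcal{L}(x(t),\lambda(t))\| = \|\nabla f(x(t)) + A^*\lambda(t)\| = o\Big(\frac{1}{\sqrt t}\Big) \quad\text{as } t \to +\infty,$$ while $$\|\nabla_\lambda \mathcal{L}(x(t),\lambda(t))\| = \|Ax(t) - b\| = O\Big(\frac{1}{t^2}\Big) \quad\text{as } t \to +\infty.$$ -/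

import Mathlib

open Filter Topology Asymptotics Set
open scoped NNReal

namespace PDAVD

noncomputable section

variable {X Y : Type*}
  [NormedAddCommGroup X] [InnerProductSpace ℝ X] [CompleteSpace X]
  [NormedAddCommGroup Y] [InnerProductSpace ℝ Y] [CompleteSpace Y]

/-- The Lagrangian `L(x, l) = f(x) + ⟨l, A x - b⟩`. -/
def lagrangian (f : X → ℝ) (A : X →L[ℝ] Y) (b : Y) (x : X) (l : Y) : ℝ :=
  f x + inner ℝ l (A x - b)

/-- The augmented Lagrangian `L_β(x, l) = L(x, l) + (β / 2) ‖A x - b‖²`. -/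
def augLagrangian (f : X → ℝ) (A : X →L[ℝ] Y) (b : Y) (β : ℝ) (x : X) (l : Y) : ℝ :=
  lagrangian f A b x l + β / 2 * ‖A x - b‖ ^ 2

/-- The set of primal-dual optimal solutions, i.e. of saddle points of the Lagrangian. -/
def saddlePoints (f : X → ℝ) (A : X →L[ℝ] Y) (b : Y) : Set (X × Y) :=
  {p | ∀ (x : X) (l : Y),
    lagrangian f A b p.1 l ≤ lagrangian f A b p.1 p.2 ∧
    lagrangian f A b p.1 p.2 ≤ lagrangian f A b x p.2}

/-- The partial gradient of `L` in its first (primal) variable at `(x, l)`. -/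
def gradPrimal (L : X → Y → ℝ) (x : X) (l : Y) : X :=
  gradient (fun z : X => L z l) x

/-- The partial gradient of `L` in its second (dual) variable at `(x, l)`. -/
def gradDual (L : X → Y → ℝ) (x : X) (l : Y) : Y :=
  gradient (fun m : Y => L x m) l

/-- The (one-sided at `t₀`) time derivative of a curve on `[t₀, ∞)`. -/
def vel {E : Type*} [NormedAddCommGroup E] [NormedSpace ℝ E] (t₀ : ℝ) (u : ℝ → E) : ℝ → E :=
  derivWithin u (Ici t₀)

/-- `(x, l)` is a twice continuously differentiable solution on `[t₀, ∞)` of the primal-dual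
system with vanishing damping, with initial positions `x₀, l₀` and initial velocities `v₀, w₀`.
Only the values of `x` and `l` on `[t₀, ∞)` matter. -/
structure IsSolution (f : X → ℝ) (A : X →L[ℝ] Y) (b : Y) (α β θ t₀ : ℝ)
    (x₀ : X) (l₀ : Y) (v₀ : X) (w₀ : Y) (x : ℝ → X) (l : ℝ → Y) : Prop where
  contDiffOn_primal : ContDiffOn ℝ 2 x (Ici t₀)
  contDiffOn_dual : ContDiffOn ℝ 2 l (Ici t₀)
  eq_primal : ∀ t ∈ Ici t₀,
    vel t₀ (vel t₀ x) t + (α / t) • vel t₀ x t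
      + gradPrimal (augLagrangian f A b β) (x t) (l t + (θ * t) • vel t₀ l t) = 0
  eq_dual : ∀ t ∈ Ici t₀,
    vel t₀ (vel t₀ l) t + (α / t) • vel t₀ l t
      - gradDual (augLagrangian f A b β) (x t + (θ * t) • vel t₀ x t) (l t) = 0
  init_primal : x t₀ = x₀
  init_dual : l t₀ = l₀
  init_vel_primal : vel t₀ x t₀ = v₀
  init_vel_dual : vel t₀ l t₀ = w₀

end

end PDAVD

/-!
The proof is a Lyapunov argument for the flow centred at the saddle point. Write `z = x - x_*`,
`m = λ - λ_*`, `g = ∇f(x) - ∇f(x_*)`, let `v`, `w` be the velocities, and let `F` be the Bregman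
distance of `f` between `x` and `x_*`. With `ξ = θ α - θ - 1 > 0`, the energy

`θ² t² (F + β/2 ‖A z‖²) + ½ ‖z + θ t v‖² + ½ ‖m + θ t w‖² + ξ/2 (‖z‖² + ‖m‖²)`

has a derivative in which the coupling terms between `z` and `m` cancel
(`CentredFlow.hasDerivAt_energy`). Because `θ < 1/2` and `∇f` is cocoercive (Baillon–Haddad,
`sub_add_norm_sq_gradient_le`), it dissipates a multiple of
`t (‖g‖² + β ‖A z‖² + ‖v‖² + ‖w‖²)`, and it bounds `m`, `t v` and `t w`.

The term `‖A^* m‖²` is missing from this dissipation. With `p = A^* m`, the primal equation reads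
`p + θ t p' = -(v' + (α / t) v + g + β A^* A z)`; pairing it with `t p` shows that
`θ/2 t² ‖p‖² + t ⟨v, p⟩` dissipates `t ‖p‖²` up to terms that the energy dissipates. A large
multiple of the energy plus this corrector is therefore a functional, bounded below, that dissipates
`t (‖p‖² + ‖g‖² + ‖v‖² + ‖w‖²) / 4` (`CentredFlow.exists_dissipated_functional`). Since `g` and `p`
are Lipschitz functions of `x` and `λ`, this already forces both to be `o(1 / √t)`: the mean value
theorem on `[t, t + 1]` finds a time at which they are small, and the dissipation of `‖v‖²`
and `‖w‖²` limits the motion on that interval (`isLittleO_one_div_sqrt_of_dissipation`).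

For the residual, `y = t w + (α - 1) m` is bounded, and by the dual equation
`r = y - θ t² A z` solves the scalar relaxation equation `t r' + k r = k y` with
`k = (1 - 2 θ) / θ > 0`. Hence `r` is bounded, and so is `t² A z` (`CentredFlow.isBigO_residual`).
-/

namespace PDAVD

/-! ### Convex functions with Lipschitz gradient -/

section Convex

variable {E : Type*} [NormedAddCommGroup E] [InnerProductSpace ℝ E] [CompleteSpace E]

lemma hasDerivAt_comp_of_hasGradientAt {f : E → ℝ} {u : ℝ → E} {g u' : E} {t : ℝ}
    (hf : HasGradientAt f g (u t)) (hu : HasDerivAt u u' t) :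
    HasDerivAt (fun s => f (u s)) (inner ℝ g u') t := by
  have h := hf.hasFDerivAt.comp_hasDerivAt t hu
  rwa [InnerProductSpace.toDual_apply_apply] at h

lemma hasDerivAt_comp_segment {f : E → ℝ} (hf : Differentiable ℝ f) (x d : E) (s : ℝ) :
    HasDerivAt (fun s : ℝ => f (x + s • d)) (inner ℝ (gradient f (x + s • d)) d) s := by
  have h : HasDerivAt (fun s : ℝ => x + s • d) d s := by
    simpa using ((hasDerivAt_id s).smul_const d).const_add x
  exact hasDerivAt_comp_of_hasGradientAt (hf _).hasGradientAt h

lemma add_inner_gradient_le {f : E → ℝ} (hf : Differentiable ℝ f)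
    (hconv : ConvexOn ℝ univ f) (x y : E) :
    f x + inner ℝ (gradient f x) (y - x) ≤ f y := by
  have hc : ConvexOn ℝ univ (fun s : ℝ => f (x + s • (y - x))) := by
    have := hconv.comp_affineMap (AffineMap.lineMap x y)
    simpa [Function.comp_def, AffineMap.lineMap_apply, add_comm] using this
  have hd := hasDerivAt_comp_segment hf x (y - x) 0
  have := hc.le_slope_of_hasDerivAt (mem_univ 0) (mem_univ 1) zero_lt_one hd
  simp only [slope_def_field, zero_smul, add_zero, one_smul, add_sub_cancel, sub_zero,
    div_one] at this
  linarith

/-- The descent inequality: a function with `L`-Lipschitz gradient lies below its quadratic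
upper model. -/
lemma le_add_inner_gradient_add {f : E → ℝ} (hf : Differentiable ℝ f) {L : ℝ}
    (hL : ∀ x y, ‖gradient f x - gradient f y‖ ≤ L * ‖x - y‖) (x d : E) :
    f (x + d) ≤ f x + inner ℝ (gradient f x) d + L / 2 * ‖d‖ ^ 2 := by
  have h1 : ∀ s : ℝ, HasDerivAt (fun s : ℝ => f (x + s • d))
      (inner ℝ (gradient f (x + s • d)) d) s := hasDerivAt_comp_segment hf x d
  have h2 : ∀ s : ℝ, HasDerivAt
      (fun s : ℝ => f x + s * inner ℝ (gradient f x) d + L / 2 * ‖d‖ ^ 2 * s ^ 2)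
      (inner ℝ (gradient f x) d + L * ‖d‖ ^ 2 * s) s := by
    intro s
    have := (((hasDerivAt_id s).mul_const (inner ℝ (gradient f x) d)).const_add (f x)).add
      ((hasDerivAt_pow 2 s).const_mul (L / 2 * ‖d‖ ^ 2))
    refine this.congr_deriv ?_
    simp
    ring
  have key := image_le_of_deriv_right_le_deriv_boundary (a := 0) (b := 1)
    (fun s _ => (h1 s).continuousAt.continuousWithinAt) (fun s _ => (h1 s).hasDerivWithinAt)
    (B := fun s : ℝ => f x + s * inner ℝ (gradient f x) d + L / 2 * ‖d‖ ^ 2 * s ^ 2)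
    (by simp) (fun s _ => (h2 s).continuousAt.continuousWithinAt)
    (fun s _ => (h2 s).hasDerivWithinAt) (fun s hs => ?_)
    (right_mem_Icc.2 zero_le_one)
  · simpa using key
  · have h3 : inner ℝ (gradient f (x + s • d) - gradient f x) d ≤ L * (s * ‖d‖) * ‖d‖ := by
      refine (real_inner_le_norm _ _).trans ?_
      gcongr
      have := hL (x + s • d) x
      rwa [add_sub_cancel_left, norm_smul, Real.norm_of_nonneg hs.1] at this
    rw [inner_sub_left] at h3
    linarith

/-- The Baillon–Haddad inequality: comparing the affine minorant of `f` at `y` with the quadratic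
upper model at `x`, at the point `x - (∇f x - ∇f y) / L`, improves the gradient inequality
by a multiple of the squared distance of the gradients. -/
lemma sub_add_norm_sq_gradient_le {f : E → ℝ} (hf : Differentiable ℝ f)
    (hconv : ConvexOn ℝ univ f) {L : ℝ} (hL0 : 0 < L)
    (hL : ∀ x y, ‖gradient f x - gradient f y‖ ≤ L * ‖x - y‖) (x y : E) :
    f x - f y - inner ℝ (gradient f y) (x - y)
        + 1 / (2 * L) * ‖gradient f x - gradient f y‖ ^ 2
      ≤ inner ℝ (gradient f x - gradient f y) (x - y) := by
  set e := gradient f x - gradient f y with he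
  have h1 := le_add_inner_gradient_add hf hL y ((1 / L) • e)
  have h2 := add_inner_gradient_le hf hconv x (y + (1 / L) • e)
  have h3 : inner ℝ (gradient f x) ((1 / L) • e) - inner ℝ (gradient f y) ((1 / L) • e)
      = 1 / L * ‖e‖ ^ 2 := by
    rw [← inner_sub_left, ← he, real_inner_smul_right, real_inner_self_eq_norm_sq]
  have h4 : y + (1 / L) • e - x = (1 / L) • e - (x - y) := by abel
  rw [norm_smul, Real.norm_of_nonneg (by positivity : 0 ≤ 1 / L)] at h1
  rw [h4, inner_sub_right] at h2
  rw [inner_sub_left]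
  have h5 : L / 2 * (1 / L * ‖e‖) ^ 2 = 1 / (2 * L) * ‖e‖ ^ 2 := by
    field_simp
  have h6 : 1 / L * ‖e‖ ^ 2 = 2 * (1 / (2 * L) * ‖e‖ ^ 2) := by
    field_simp
  linarith

end Convex

/-! ### Decay from a dissipated functional -/

section Decay

variable {E H : Type*} [NormedAddCommGroup E] [NormedSpace ℝ E] [NormedAddCommGroup H]

lemma antitoneOn_Ici_of_hasDerivAt_nonpos {W W' : ℝ → ℝ} {T : ℝ}
    (hW : ∀ t ≥ T, HasDerivAt W (W' t) t) (hW' : ∀ t ≥ T, W' t ≤ 0) :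
    AntitoneOn W (Ici T) := by
  refine antitoneOn_of_deriv_nonpos (convex_Ici T)
    (fun t ht => (hW t ht).continuousAt.continuousWithinAt)
    (fun t ht => (hW t (interior_subset ht)).differentiableAt.differentiableWithinAt) ?_
  intro t ht
  rw [(hW t (interior_subset ht)).deriv]
  exact hW' t (interior_subset ht)

lemma tendsto_sub_add_one_of_antitoneOn {W : ℝ → ℝ} {T B : ℝ} (hW : AntitoneOn W (Ici T))
    (hB : ∀ t ≥ T, B ≤ W t) : Tendsto (fun t => W t - W (t + 1)) atTop (𝓝 0) := by
  have hanti : Antitone (fun t => W (max T t)) := fun s t hst =>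
    hW (le_max_left T s) (le_max_left T t) (max_le_max le_rfl hst)
  have hlim := tendsto_atTop_ciInf hanti
    ⟨B, by rintro _ ⟨t, rfl⟩; exact hB _ (le_max_left _ _)⟩
  have h2 := hlim.sub (hlim.comp (tendsto_atTop_add_const_right _ (1 : ℝ) tendsto_id))
  rw [sub_self] at h2
  refine h2.congr' ?_
  filter_upwards [eventually_ge_atTop T] with t ht
  simp only [Function.comp_apply, id]
  rw [max_eq_right ht, max_eq_right (by linarith)]

/-- If a functional that is bounded below dissipates `t * (‖q t‖² + ‖u' t‖²)`, and `q` is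
Lipschitz along the curve `u`, then `‖q t‖ = o(1 / √t)`: the dissipation on `[t, t + 1]` tends
to zero, so somewhere on that interval `√t * ‖q‖` is small, and `u`, hence `q`, moves
by only a small multiple of `1 / √t` there. -/
lemma isLittleO_one_div_sqrt_of_dissipation {W W' : ℝ → ℝ} {u u' : ℝ → E} {q : ℝ → H}
    {T B c L : ℝ} (hc : 0 < c) (hL : 0 ≤ L)
    (hW : ∀ t ≥ T, HasDerivAt W (W' t) t) (hB : ∀ t ≥ T, B ≤ W t)
    (hu : ∀ t ≥ T, HasDerivAt u (u' t) t)
    (hdiss : ∀ t ≥ T, W' t ≤ -(c * t * (‖q t‖ ^ 2 + ‖u' t‖ ^ 2)))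
    (hq : ∀ s ≥ T, ∀ t ≥ T, ‖q s - q t‖ ≤ L * ‖u s - u t‖) :
    (fun t => ‖q t‖) =o[atTop] (fun t : ℝ => 1 / √t) := by
  have hdrop : Tendsto (fun t => W t - W (t + 1)) atTop (𝓝 0) := by
    have hanti : AntitoneOn W (Ici (max T 0)) :=
      antitoneOn_Ici_of_hasDerivAt_nonpos (fun t ht => hW t (le_trans (le_max_left _ _) ht))
        (fun t ht => (hdiss t (le_trans (le_max_left _ _) ht)).trans (by
          have : 0 ≤ t := le_trans (le_max_right _ _) ht
          have : 0 ≤ c * t * (‖q t‖ ^ 2 + ‖u' t‖ ^ 2) := by positivity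
          linarith))
    exact tendsto_sub_add_one_of_antitoneOn hanti
      (fun t ht => hB t (le_trans (le_max_left _ _) ht))
  rw [isLittleO_iff]
  intro δ hδ
  -- `ε` is chosen so that the two contributions below add up to `δ / √t`
  set M : ℝ := 1 + L * (1 / 2 + 1 / (2 * c)) with hM
  have hMpos : 0 < M := by positivity
  set ε : ℝ := δ / M with hε
  have hεpos : 0 < ε := by positivity
  have hsmall : ∀ᶠ t in atTop, W t - W (t + 1) < min (c * ε ^ 2) (ε ^ 2) :=
    hdrop.eventually_lt_const (by positivity)
  filter_upwards [hsmall, eventually_ge_atTop T, eventually_gt_atTop 0] with t ht htT ht0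
  have hD1 : W t - W (t + 1) < c * ε ^ 2 := ht.trans_le (min_le_left _ _)
  have hD2 : W t - W (t + 1) < ε ^ 2 := ht.trans_le (min_le_right _ _)
  have hsq : 0 < √t := Real.sqrt_pos.2 ht0
  have hsqt : √t * √t = t := Real.mul_self_sqrt ht0.le
  obtain ⟨s, hs, hsW⟩ := exists_hasDerivAt_eq_slope W W' (lt_add_one t)
    (fun r hr => (hW r (htT.trans hr.1)).continuousAt.continuousWithinAt)
    (fun r hr => hW r (htT.trans hr.1.le))
  rw [add_sub_cancel_left, div_one] at hsW
  have hsT : T ≤ s := htT.trans hs.1.le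
  have hqs : ‖q s‖ ≤ ε / √t := by
    have h1 := hdiss s hsT
    have h2 : c * t * ‖q s‖ ^ 2 ≤ c * ε ^ 2 := by
      have h3 : c * t * ‖q s‖ ^ 2 ≤ c * s * (‖q s‖ ^ 2 + ‖u' s‖ ^ 2) := by
        gcongr
        · exact mul_nonneg hc.le (ht0.trans hs.1).le
        · exact hs.1.le
        · nlinarith [sq_nonneg ‖u' s‖]
      linarith
    have h4 : (√t * ‖q s‖) ^ 2 ≤ ε ^ 2 := by
      rw [mul_pow, sq (√t), hsqt]
      nlinarith
    rw [le_div_iff₀ hsq, mul_comm]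
    exact abs_le_of_sq_le_sq' h4 hεpos.le |>.2
  -- Young's inequality with weight `√t / ε` bounds `‖u'‖` by the derivative of `Bd`
  set Bd : ℝ → ℝ := fun r =>
    ε / (2 * √t) * (r - t) + (1 / (2 * c * ε * √t)) * (W t - W r) with hBd
  have hBd' : ∀ r ≥ T, HasDerivAt Bd (ε / (2 * √t) + 1 / (2 * c * ε * √t) * (-W' r)) r := by
    intro r hr
    have := (((hasDerivAt_id r).sub_const t).const_mul (ε / (2 * √t))).add
      (((hW r hr).const_sub (W t)).const_mul (1 / (2 * c * ε * √t)))
    refine this.congr_deriv ?_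
    simp
  have hmove : ‖u s - u t‖ ≤ Bd s := by
    refine image_norm_le_of_norm_deriv_right_le_deriv_boundary' (f := fun r => u r - u t)
      (f' := u') (a := t) (b := t + 1)
      (fun r hr => ((hu r (htT.trans hr.1)).sub_const _).continuousAt.continuousWithinAt)
      (fun r hr => ((hu r (htT.trans hr.1)).sub_const _).hasDerivWithinAt)
      (by simp [hBd]) (fun r hr => (hBd' r (htT.trans hr.1)).continuousAt.continuousWithinAt)
      (fun r hr => (hBd' r (htT.trans hr.1)).hasDerivWithinAt) ?_ ⟨hs.1.le, hs.2.le⟩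
    intro r hr
    have hrT := htT.trans hr.1
    have h1 : c * t * ‖u' r‖ ^ 2 ≤ -W' r := by
      have h3 : c * t * ‖u' r‖ ^ 2 ≤ c * r * (‖q r‖ ^ 2 + ‖u' r‖ ^ 2) := by
        gcongr
        · exact mul_nonneg hc.le (ht0.le.trans hr.1)
        · exact hr.1
        · nlinarith [sq_nonneg ‖q r‖]
      linarith [hdiss r hrT]
    have h2 : 1 / (2 * c * ε * √t) * (c * t * ‖u' r‖ ^ 2)
        ≤ 1 / (2 * c * ε * √t) * (-W' r) := by gcongr
    have h3 : 1 / (2 * c * ε * √t) * (c * t * ‖u' r‖ ^ 2) = √t * ‖u' r‖ ^ 2 / (2 * ε) := by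
      field_simp
      rw [sq (√t), hsqt]
    have h4 : ‖u' r‖ ≤ ε / (2 * √t) + √t * ‖u' r‖ ^ 2 / (2 * ε) := by
      have h5 : ε / (2 * √t) + √t * ‖u' r‖ ^ 2 / (2 * ε) - ‖u' r‖
          = (ε - √t * ‖u' r‖) ^ 2 / (2 * ε * √t) := by
        field_simp
        ring
      have : 0 ≤ (ε - √t * ‖u' r‖) ^ 2 / (2 * ε * √t) := by positivity
      linarith
    linarith
  have hBs : Bd s ≤ ε / √t * (1 / 2 + 1 / (2 * c)) := by
    have hWs : W (t + 1) ≤ W s := by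
      refine antitoneOn_Ici_of_hasDerivAt_nonpos (T := t) (fun r hr => hW r (htT.trans hr))
        (fun r hr => (hdiss r (htT.trans hr)).trans ?_) hs.1.le
        (hs.1.le.trans hs.2.le) hs.2.le
      have : 0 ≤ r := ht0.le.trans hr
      have : 0 ≤ c * r * (‖q r‖ ^ 2 + ‖u' r‖ ^ 2) := by positivity
      linarith
    have h1 : ε / (2 * √t) * (s - t) ≤ ε / (2 * √t) * 1 := by
      gcongr
      linarith [hs.2]
    have h2 : 1 / (2 * c * ε * √t) * (W t - W s) ≤ 1 / (2 * c * ε * √t) * ε ^ 2 := by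
      gcongr
      linarith
    have h3 : ε / (2 * √t) * 1 + 1 / (2 * c * ε * √t) * ε ^ 2
        = ε / √t * (1 / 2 + 1 / (2 * c)) := by
      field_simp
    simp only [hBd]
    linarith
  have hqt : ‖q t‖ ≤ ε / √t * M := by
    have h1 : ‖q t‖ ≤ ‖q s‖ + ‖q s - q t‖ := by
      have := norm_sub_norm_le (q t) (q s)
      rw [norm_sub_rev] at this
      linarith
    have h2 : ‖q s - q t‖ ≤ L * (ε / √t * (1 / 2 + 1 / (2 * c))) :=
      (hq s hsT t htT).trans (by gcongr; exact hmove.trans hBs)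
    have h3 : ε / √t * M = ε / √t + L * (ε / √t * (1 / 2 + 1 / (2 * c))) := by
      rw [hM]; ring
    linarith
  rw [norm_norm, Real.norm_of_nonneg (by positivity)]
  refine hqt.trans_eq ?_
  rw [hε]
  field_simp

/-- If `t * r' + k * r = k * y` with `k > 0` and `y` bounded, then `r` is bounded, as `t ^ k * r`
has derivative `k * t ^ (k - 1) * y`. -/
lemma exists_norm_le_of_relaxation {r r' y : ℝ → E} {T k C : ℝ} (hT : 0 < T) (hk : 0 < k)
    (hr : ∀ t ≥ T, HasDerivAt r (r' t) t) (hode : ∀ t ≥ T, t • r' t + k • r t = k • y t)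
    (hy : ∀ t ≥ T, ‖y t‖ ≤ C) : ∃ B, ∀ t ≥ T, ‖r t‖ ≤ B := by
  have hC : 0 ≤ C := (norm_nonneg _).trans (hy T le_rfl)
  refine ⟨‖r T‖ + C, fun t ht => ?_⟩
  have hpow : ∀ s ≥ T, HasDerivAt (fun s : ℝ => s ^ k) (k * s ^ (k - 1)) s := fun s hs =>
    Real.hasDerivAt_rpow_const (Or.inl (hT.trans_le hs).ne')
  have hder : ∀ s ≥ T, HasDerivAt (fun s : ℝ => s ^ k • r s) ((k * s ^ (k - 1)) • y s) s := by
    intro s hs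
    have hs0 : 0 < s := hT.trans_le hs
    refine ((hpow s hs).smul (hr s hs)).congr_deriv ?_
    have h1 : s ^ k = s ^ (k - 1) * s := by
      rw [← Real.rpow_add_one hs0.ne', sub_add_cancel]
    rw [h1, mul_smul, mul_comm k, mul_smul, mul_smul, ← smul_add, hode s hs]
  have hBd : ∀ s ≥ T, HasDerivAt (fun s : ℝ => T ^ k * ‖r T‖ + C * (s ^ k - T ^ k))
      (C * (k * s ^ (k - 1))) s := fun s hs =>
    (((hpow s hs).sub_const _).const_mul C).const_add _
  have key := image_norm_le_of_norm_deriv_right_le_deriv_boundary' (a := T) (b := t)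
    (fun s hs => (hder s hs.1).continuousAt.continuousWithinAt)
    (fun s hs => (hder s hs.1).hasDerivWithinAt)
    (by
      simp only [sub_self, mul_zero, add_zero]
      rw [norm_smul, Real.norm_of_nonneg (by positivity)])
    (fun s hs => (hBd s hs.1).continuousAt.continuousWithinAt)
    (fun s hs => (hBd s hs.1).hasDerivWithinAt)
    (fun s hs => by
      have hs0 : 0 < s := hT.trans_le hs.1
      rw [norm_smul, Real.norm_of_nonneg (by positivity), mul_comm]
      gcongr
      exact hy s hs.1)
    (right_mem_Icc.2 ht)
  have ht0 : 0 < t := hT.trans_le ht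
  rw [norm_smul, Real.norm_of_nonneg (by positivity)] at key
  have hTt : T ^ k ≤ t ^ k := Real.rpow_le_rpow hT.le ht hk.le
  have htk : 0 < t ^ k := by positivity
  have hTk : 0 < T ^ k := by positivity
  refine le_of_mul_le_mul_left (key.trans ?_) htk
  have h1 : T ^ k * ‖r T‖ ≤ t ^ k * ‖r T‖ := by gcongr
  have h2 : C * (t ^ k - T ^ k) ≤ C * t ^ k := by
    gcongr
    linarith
  linarith

end Decay

/-! ### The flow centred at a saddle point -/

section Flow

variable {X Y : Type*}
  [NormedAddCommGroup X] [InnerProductSpace ℝ X] [CompleteSpace X]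
  [NormedAddCommGroup Y] [InnerProductSpace ℝ Y] [CompleteSpace Y]

/-- The dynamics seen from a saddle point, on `[T, ∞)`. Here `z`, `v`, `a` stand for
`x - x_*` and its first two derivatives, `m`, `w`, `c` for `λ - λ_*` and its first two
derivatives, `g` for `∇f(x) - ∇f(x_*)` and `F` for the Bregman distance
`f(x) - f(x_*) - ⟨∇f(x_*), x - x_*⟩`. Both equations of motion are multiplied by `t`. Convexity
and Lipschitz continuity of `∇f` enter only through the last two fields. -/
structure CentredFlow (A : X →L[ℝ] Y) (α β θ κ T : ℝ) (F : ℝ → ℝ) (z v a g : ℝ → X)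
    (m w c : ℝ → Y) : Prop where
  hz : ∀ t ≥ T, HasDerivAt z (v t) t
  hv : ∀ t ≥ T, HasDerivAt v (a t) t
  hm : ∀ t ≥ T, HasDerivAt m (w t) t
  hw : ∀ t ≥ T, HasDerivAt w (c t) t
  hF : ∀ t ≥ T, HasDerivAt F (inner ℝ (g t) (v t)) t
  eq_primal : ∀ t ≥ T, t • a t + α • v t
    + t • (g t + β • A.adjoint (A (z t)) + A.adjoint (m t + (θ * t) • w t)) = 0
  eq_dual : ∀ t ≥ T, t • c t + α • w t = t • A (z t + (θ * t) • v t)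
  F_nonneg : ∀ t ≥ T, 0 ≤ F t
  cocoercive : ∀ t ≥ T, F t + κ * ‖g t‖ ^ 2 ≤ inner ℝ (g t) (z t)

/-- The Lyapunov function of the primal-dual flow, with `ξ = θ * α - θ - 1`. -/
noncomputable def energy (A : X →L[ℝ] Y) (α β θ : ℝ) (F : ℝ → ℝ) (z v : ℝ → X)
    (m w : ℝ → Y) (t : ℝ) : ℝ :=
  θ ^ 2 * t ^ 2 * (F t + β / 2 * ‖A (z t)‖ ^ 2)
    + (1 / 2 * ‖z t + (θ * t) • v t‖ ^ 2 + 1 / 2 * ‖m t + (θ * t) • w t‖ ^ 2)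
    + (θ * α - θ - 1) / 2 * (‖z t‖ ^ 2 + ‖m t‖ ^ 2)

/-- The correction of the energy that detects `A^*(λ - λ_*)`; it is bounded below because
`t * v t` and `m t` are bounded. -/
noncomputable def corrector (A : X →L[ℝ] Y) (θ : ℝ) (v : ℝ → X) (m : ℝ → Y) (t : ℝ) : ℝ :=
  θ / 2 * t ^ 2 * ‖A.adjoint (m t)‖ ^ 2 + t * inner ℝ (v t) (A.adjoint (m t))

namespace CentredFlow

variable {A : X →L[ℝ] Y} {α β θ κ T : ℝ} {F : ℝ → ℝ} {z v a g : ℝ → X} {m w c : ℝ → Y}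

lemma hasDerivAt_extrapolate {E : Type*} [NormedAddCommGroup E] [NormedSpace ℝ E]
    {u p q : ℝ → E} {t : ℝ} (hu : HasDerivAt u (p t) t) (hp : HasDerivAt p (q t) t) :
    HasDerivAt (fun t => u t + (θ * t) • p t)
      ((1 + θ - θ * α) • p t + θ • (t • q t + α • p t)) t := by
  have h1 : HasDerivAt (fun t : ℝ => θ * t) θ t := by
    simpa using (hasDerivAt_id t).const_mul θ
  refine (hu.add (h1.smul hp)).congr_deriv ?_
  module

/-- Along the flow the terms coupling `z` and `m` cancel in the derivative of the energy. -/
lemma hasDerivAt_energy (h : CentredFlow A α β θ κ T F z v a g m w c) {t : ℝ} (ht : T ≤ t) :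
    HasDerivAt (energy A α β θ F z v m w)
      (2 * θ ^ 2 * t * (F t + β / 2 * ‖A (z t)‖ ^ 2)
        - θ * t * (inner ℝ (g t) (z t) + β * ‖A (z t)‖ ^ 2)
        - (θ * α - θ - 1) * θ * t * (‖v t‖ ^ 2 + ‖w t‖ ^ 2)) t := by
  have hV := hasDerivAt_extrapolate (θ := θ) (α := α) (h.hz t ht) (h.hv t ht)
  have hW := hasDerivAt_extrapolate (θ := θ) (α := α) (h.hm t ht) (h.hw t ht)
  have e1 : t • a t + α • v t
      = -(t • (g t + β • A.adjoint (A (z t)) + A.adjoint (m t + (θ * t) • w t))) :=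
    eq_neg_of_add_eq_zero_left (h.eq_primal t ht)
  rw [e1] at hV
  rw [h.eq_dual t ht] at hW
  have hAz : HasDerivAt (fun t => A (z t)) (A (v t)) t :=
    A.hasFDerivAt.comp_hasDerivAt t (h.hz t ht)
  have hsq : HasDerivAt (fun t : ℝ => θ ^ 2 * t ^ 2) (θ ^ 2 * (2 * t)) t := by
    simpa using (hasDerivAt_pow 2 t).const_mul (θ ^ 2)
  have hE := ((hsq.mul ((h.hF t ht).add (hAz.norm_sq.const_mul (β / 2)))).add
    ((hV.norm_sq.const_mul (1 / 2)).add (hW.norm_sq.const_mul (1 / 2)))).add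
    (((h.hz t ht).norm_sq.add (h.hm t ht).norm_sq).const_mul ((θ * α - θ - 1) / 2))
  refine hE.congr_deriv ?_
  simp only [inner_add_left, inner_add_right, inner_neg_right, real_inner_smul_left,
    real_inner_smul_right, ContinuousLinearMap.adjoint_inner_right, map_add, map_smul, smul_add,
    smul_neg]
  rw [real_inner_comm (A (z t)) (m t), real_inner_comm (A (z t)) (w t),
    real_inner_comm (A (v t)) (m t), real_inner_comm (A (v t)) (w t),
    real_inner_comm (A (v t)) (A (z t)), real_inner_comm (g t) (z t),
    real_inner_comm (g t) (v t)]
  simp only [real_inner_self_eq_norm_sq]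
  simp only [Pi.add_apply]
  ring

lemma hasDerivAt_corrector (h : CentredFlow A α β θ κ T F z v a g m w c) {t : ℝ} (ht : T ≤ t) :
    HasDerivAt (corrector A θ v m)
      ((θ - 1) * t * ‖A.adjoint (m t)‖ ^ 2 + (1 - α) * inner ℝ (v t) (A.adjoint (m t))
        - t * inner ℝ (g t) (A.adjoint (m t))
        - t * β * inner ℝ (A.adjoint (A (z t))) (A.adjoint (m t))
        + t * inner ℝ (v t) (A.adjoint (w t))) t := by
  have hp : HasDerivAt (fun t => A.adjoint (m t)) (A.adjoint (w t)) t :=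
    A.adjoint.hasFDerivAt.comp_hasDerivAt t (h.hm t ht)
  have hsq : HasDerivAt (fun t : ℝ => θ / 2 * t ^ 2) (θ / 2 * (2 * t)) t := by
    simpa using (hasDerivAt_pow 2 t).const_mul (θ / 2)
  have hd := (hsq.mul hp.norm_sq).add ((hasDerivAt_id t).mul ((h.hv t ht).inner ℝ hp))
  refine hd.congr_deriv ?_
  have e1 : t • a t = -(t • (g t + β • A.adjoint (A (z t))
      + A.adjoint (m t + (θ * t) • w t)) + α • v t) :=
    eq_neg_of_add_eq_zero_left (by rw [← h.eq_primal t ht]; abel)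
  have e2 : t * inner ℝ (a t) (A.adjoint (m t)) = inner ℝ (t • a t) (A.adjoint (m t)) :=
    (real_inner_smul_left _ _ _).symm
  simp only [id, one_mul, mul_add]
  rw [e2, e1]
  simp only [inner_add_left, inner_neg_left, real_inner_smul_left, map_add, map_smul, smul_add]
  rw [real_inner_comm (A.adjoint (m t)) (A.adjoint (w t)), real_inner_self_eq_norm_sq]
  ring

/-- Cocoercivity makes the energy dissipate every quantity but `A^*(λ - λ_*)`. -/
lemma exists_energy_dissipation (h : CentredFlow A α β θ κ T F z v a g m w c) (hT : 0 < T)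
    (hβ : 0 ≤ β) (hθ₀ : 0 < θ) (hθ : θ < 1 / 2) (hξ : 0 < θ * α - θ - 1) (hκ : 0 < κ) :
    ∃ δ > 0, ∀ t ≥ T, 2 * θ ^ 2 * t * (F t + β / 2 * ‖A (z t)‖ ^ 2)
        - θ * t * (inner ℝ (g t) (z t) + β * ‖A (z t)‖ ^ 2)
        - (θ * α - θ - 1) * θ * t * (‖v t‖ ^ 2 + ‖w t‖ ^ 2)
      ≤ -(δ * t * (‖g t‖ ^ 2 + β * ‖A (z t)‖ ^ 2 + ‖v t‖ ^ 2 + ‖w t‖ ^ 2)) := by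
  refine ⟨θ * min κ (min (1 / 2) (θ * α - θ - 1)), by positivity, fun t ht => ?_⟩
  set δ := min κ (min (1 / 2) (θ * α - θ - 1)) with hδ
  have d1 : δ ≤ κ := min_le_left _ _
  have d2 : δ ≤ 1 / 2 := (min_le_right _ _).trans (min_le_left _ _)
  have d3 : δ ≤ θ * α - θ - 1 := (min_le_right _ _).trans (min_le_right _ _)
  have ht0 : 0 < t := hT.trans_le ht
  have hc := h.cocoercive t ht
  have hF := h.F_nonneg t ht
  have i1 : δ * ‖g t‖ ^ 2 ≤ κ * ‖g t‖ ^ 2 := by gcongr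
  have i2 : δ * (β * ‖A (z t)‖ ^ 2) ≤ 1 / 2 * (β * ‖A (z t)‖ ^ 2) := by gcongr
  have i3 : δ * (‖v t‖ ^ 2 + ‖w t‖ ^ 2) ≤ (θ * α - θ - 1) * (‖v t‖ ^ 2 + ‖w t‖ ^ 2) := by gcongr
  have i4 : 2 * θ * F t ≤ 1 * F t := by
    gcongr
    linarith
  have i5 : θ * (β * ‖A (z t)‖ ^ 2) ≤ 1 / 2 * (β * ‖A (z t)‖ ^ 2) := by gcongr
  have key : 2 * θ * (F t + β / 2 * ‖A (z t)‖ ^ 2)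
      - (inner ℝ (g t) (z t) + β * ‖A (z t)‖ ^ 2)
      - (θ * α - θ - 1) * (‖v t‖ ^ 2 + ‖w t‖ ^ 2)
      ≤ -(δ * (‖g t‖ ^ 2 + β * ‖A (z t)‖ ^ 2 + ‖v t‖ ^ 2 + ‖w t‖ ^ 2)) := by
    linarith
  have := mul_le_mul_of_nonneg_left key (by positivity : 0 ≤ θ * t)
  linarith

lemma norm_smul_le_of_extrapolate {E : Type*} [NormedAddCommGroup E] [NormedSpace ℝ E]
    {u p : E} {t C₁ C₂ : ℝ} (hθ₀ : 0 < θ) (hu : ‖u‖ ≤ C₁) (hp : ‖u + (θ * t) • p‖ ≤ C₂) :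
    ‖t • p‖ ≤ (C₂ + C₁) / θ := by
  rw [le_div_iff₀ hθ₀]
  have h1 : (u + (θ * t) • p) - u = θ • t • p := by rw [mul_smul]; abel
  have h2 := norm_sub_le (u + (θ * t) • p) u
  rw [h1, norm_smul, Real.norm_of_nonneg hθ₀.le] at h2
  linarith

lemma exists_bounds (h : CentredFlow A α β θ κ T F z v a g m w c) (hT : 0 < T)
    (hβ : 0 ≤ β) (hθ₀ : 0 < θ) (hθ : θ < 1 / 2) (hξ : 0 < θ * α - θ - 1) (hκ : 0 < κ) :
    ∃ C, ∀ t ≥ T, ‖m t‖ ≤ C ∧ ‖t • v t‖ ≤ C ∧ ‖t • w t‖ ≤ C := by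
  obtain ⟨δ, hδ, hdiss⟩ := h.exists_energy_dissipation hT hβ hθ₀ hθ hξ hκ
  have hanti := antitoneOn_Ici_of_hasDerivAt_nonpos (fun t ht => h.hasDerivAt_energy ht)
    (fun t ht => (hdiss t ht).trans (by
      have : 0 < t := hT.trans_le ht
      have : 0 ≤ δ * t * (‖g t‖ ^ 2 + β * ‖A (z t)‖ ^ 2 + ‖v t‖ ^ 2 + ‖w t‖ ^ 2) := by positivity
      linarith))
  set E₀ := energy A α β θ F z v m w T with hE₀
  set ξ := θ * α - θ - 1 with hξdef
  have hterms : ∀ t ≥ T, ‖z t‖ ^ 2 ≤ 2 * E₀ / ξ ∧ ‖m t‖ ^ 2 ≤ 2 * E₀ / ξ ∧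
      ‖z t + (θ * t) • v t‖ ^ 2 ≤ 2 * E₀ ∧ ‖m t + (θ * t) • w t‖ ^ 2 ≤ 2 * E₀ := by
    intro t ht
    have hle : energy A α β θ F z v m w t ≤ E₀ := hanti self_mem_Ici ht ht
    rw [energy, ← hξdef] at hle
    have hF := h.F_nonneg t ht
    have p1 : 0 ≤ θ ^ 2 * t ^ 2 * (F t + β / 2 * ‖A (z t)‖ ^ 2) := by positivity
    have p2 : 0 ≤ ξ * ‖z t‖ ^ 2 := by positivity
    have p3 : 0 ≤ ξ * ‖m t‖ ^ 2 := by positivity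
    have p4 := sq_nonneg ‖z t + (θ * t) • v t‖
    have p5 := sq_nonneg ‖m t + (θ * t) • w t‖
    refine ⟨?_, ?_, ?_, ?_⟩
    · rw [le_div_iff₀ hξ]; linarith
    · rw [le_div_iff₀ hξ]; linarith
    · linarith
    · linarith
  set C₁ := √(2 * E₀ / ξ)
  set C₂ := √(2 * E₀)
  refine ⟨max C₁ ((C₂ + C₁) / θ), fun t ht => ?_⟩
  obtain ⟨b1, b2, b3, b4⟩ := hterms t ht
  refine ⟨(Real.le_sqrt_of_sq_le b2).trans (le_max_left _ _), ?_, ?_⟩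
  · exact (norm_smul_le_of_extrapolate hθ₀ (Real.le_sqrt_of_sq_le b1)
      (Real.le_sqrt_of_sq_le b3)).trans (le_max_right _ _)
  · exact (norm_smul_le_of_extrapolate hθ₀ (Real.le_sqrt_of_sq_le b2)
      (Real.le_sqrt_of_sq_le b4)).trans (le_max_right _ _)

/-- The corrector dissipates `t * ‖A^*(λ - λ_*)‖²` up to quantities dissipated by the energy. -/
lemma exists_corrector_dissipation (A : X →L[ℝ] Y) (hT : 0 < T) (hβ : 0 ≤ β) (hθ : θ < 1 / 2) :
    ∃ M ≥ 0, ∀ t ≥ T, ∀ (z v g : X) (m w : Y),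
      (θ - 1) * t * ‖A.adjoint m‖ ^ 2 + (1 - α) * inner ℝ v (A.adjoint m)
        - t * inner ℝ g (A.adjoint m)
        - t * β * inner ℝ (A.adjoint (A z)) (A.adjoint m)
        + t * inner ℝ v (A.adjoint w)
      ≤ -(1 / 4 * t * ‖A.adjoint m‖ ^ 2)
        + M * t * (‖g‖ ^ 2 + β * ‖A z‖ ^ 2 + ‖v‖ ^ 2 + ‖w‖ ^ 2) := by
  refine ⟨4 * (α - 1) ^ 2 / T ^ 2 + 1 / 2 + 4 + 4 * β * ‖A‖ ^ 2 + ‖A‖ ^ 2 / 2,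
    by positivity, fun t ht z v g m w => ?_⟩
  have ht0 : 0 < t := hT.trans_le ht
  set p := A.adjoint m with hp
  -- Young's inequality with the weight that leaves `‖p‖² / 16`
  have young : ∀ x : X, inner ℝ x p ≤ ‖p‖ ^ 2 / 16 + 4 * ‖x‖ ^ 2 := fun x => by
    have h1 := real_inner_le_norm x p
    nlinarith [sq_nonneg (‖p‖ / 4 - 2 * ‖x‖)]
  have y1 := mul_le_mul_of_nonneg_left (young (((1 - α) / t) • v)) ht0.le
  have y2 := mul_le_mul_of_nonneg_left (young (-g)) ht0.le
  have y3 := mul_le_mul_of_nonneg_left (young (-(β • A.adjoint (A z)))) ht0.le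
  rw [real_inner_smul_left, norm_smul, mul_pow, Real.norm_eq_abs, sq_abs] at y1
  rw [inner_neg_left, norm_neg] at y2
  rw [inner_neg_left, real_inner_smul_left, norm_neg, norm_smul, Real.norm_of_nonneg hβ] at y3
  have e1 : t * ((1 - α) / t * inner ℝ v p) = (1 - α) * inner ℝ v p := by field_simp
  have e2 : ((1 - α) / t) ^ 2 * ‖v‖ ^ 2 ≤ (α - 1) ^ 2 / T ^ 2 * ‖v‖ ^ 2 := by
    have h1 : ((1 - α) / t) ^ 2 = (α - 1) ^ 2 / t ^ 2 := by
      rw [div_pow]; congr 1; ring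
    rw [h1]
    gcongr
  have e3 : (β * ‖A.adjoint (A z)‖) ^ 2 ≤ β * ‖A‖ ^ 2 * (β * ‖A z‖ ^ 2) := by
    have h1 : ‖A.adjoint (A z)‖ ≤ ‖A‖ * ‖A z‖ := by
      simpa using A.adjoint.le_opNorm (A z)
    calc (β * ‖A.adjoint (A z)‖) ^ 2 ≤ (β * (‖A‖ * ‖A z‖)) ^ 2 := by gcongr
      _ = _ := by ring
  have e4 : inner ℝ v (A.adjoint w) ≤ 1 / 2 * ‖v‖ ^ 2 + ‖A‖ ^ 2 / 2 * ‖w‖ ^ 2 := by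
    have h1 : ‖A.adjoint w‖ ≤ ‖A‖ * ‖w‖ := by
      simpa using A.adjoint.le_opNorm w
    have h2 := (real_inner_le_norm v (A.adjoint w)).trans
      (mul_le_mul_of_nonneg_left h1 (norm_nonneg v))
    nlinarith [sq_nonneg (‖v‖ - ‖A‖ * ‖w‖)]
  have t2 := mul_le_mul_of_nonneg_left e2 ht0.le
  have t3 := mul_le_mul_of_nonneg_left e3 ht0.le
  have t4 := mul_le_mul_of_nonneg_left e4 ht0.le
  have t5 : θ * (t * ‖p‖ ^ 2) ≤ 1 / 2 * (t * ‖p‖ ^ 2) := by gcongr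
  have q0 : 0 ≤ t * ‖p‖ ^ 2 := by positivity
  have gβ : 0 ≤ β * ‖A z‖ ^ 2 := by positivity
  obtain ⟨Q, hQ⟩ : ∃ Q, Q = ‖g‖ ^ 2 + β * ‖A z‖ ^ 2 + ‖v‖ ^ 2 + ‖w‖ ^ 2 := ⟨_, rfl⟩
  have g1 := sq_nonneg ‖g‖
  have g2 := sq_nonneg ‖v‖
  have g3 := sq_nonneg ‖w‖
  have r1 : (4 * (α - 1) ^ 2 / T ^ 2 + 1 / 2) * ‖v‖ ^ 2
      ≤ (4 * (α - 1) ^ 2 / T ^ 2 + 1 / 2) * Q :=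
    mul_le_mul_of_nonneg_left (by linarith) (by positivity)
  have r2 : 4 * ‖g‖ ^ 2 ≤ 4 * Q := by linarith
  have r3 : 4 * β * ‖A‖ ^ 2 * (β * ‖A z‖ ^ 2) ≤ 4 * β * ‖A‖ ^ 2 * Q :=
    mul_le_mul_of_nonneg_left (by linarith) (by positivity)
  have r4 : ‖A‖ ^ 2 / 2 * ‖w‖ ^ 2 ≤ ‖A‖ ^ 2 / 2 * Q :=
    mul_le_mul_of_nonneg_left (by linarith) (by positivity)
  have r := mul_le_mul_of_nonneg_left (add_le_add (add_le_add r1 r2) (add_le_add r3 r4)) ht0.le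
  have e5 : 4 * (α - 1) ^ 2 / T ^ 2 = 4 * ((α - 1) ^ 2 / T ^ 2) := by ring
  rw [← hQ]
  rw [e5] at r ⊢
  linarith

/-- A positive multiple of the energy plus the corrector is a functional, bounded below, that
dissipates all the quantities whose decay is claimed. -/
lemma exists_dissipated_functional (h : CentredFlow A α β θ κ T F z v a g m w c) (hT : 0 < T)
    (hβ : 0 ≤ β) (hθ₀ : 0 < θ) (hθ : θ < 1 / 2) (hξ : 0 < θ * α - θ - 1) (hκ : 0 < κ) :
    ∃ (W W' : ℝ → ℝ) (B : ℝ), (∀ t ≥ T, HasDerivAt W (W' t) t) ∧ (∀ t ≥ T, B ≤ W t) ∧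
      ∀ t ≥ T, W' t ≤
        -(1 / 4 * t * (‖A.adjoint (m t)‖ ^ 2 + ‖g t‖ ^ 2 + ‖v t‖ ^ 2 + ‖w t‖ ^ 2)) := by
  obtain ⟨δ, hδ, hE⟩ := h.exists_energy_dissipation hT hβ hθ₀ hθ hξ hκ
  obtain ⟨M, hM, hΦ⟩ := exists_corrector_dissipation (α := α) (θ := θ) A hT hβ hθ
  obtain ⟨C, hC⟩ := h.exists_bounds hT hβ hθ₀ hθ hξ hκ
  have hC0 : 0 ≤ C := (norm_nonneg _).trans (hC T le_rfl).1
  -- `(M + 1) / δ` copies of the energy pay for the corrector's error `M` and leave a surplus of `1`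
  refine ⟨_, _, -(C * (‖A‖ * C)), fun t ht => ((h.hasDerivAt_energy ht).const_mul
    ((M + 1) / δ)).add (h.hasDerivAt_corrector ht), fun t ht => ?_, fun t ht => ?_⟩
  · have ht0 : 0 < t := hT.trans_le ht
    obtain ⟨b1, b2, -⟩ := hC t ht
    have hF := h.F_nonneg t ht
    have p1 : 0 ≤ (M + 1) / δ * energy A α β θ F z v m w t := by
      rw [energy]; positivity
    have p2 : 0 ≤ θ / 2 * t ^ 2 * ‖A.adjoint (m t)‖ ^ 2 := by positivity
    have p3 : ‖A.adjoint (m t)‖ ≤ ‖A‖ * C := by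
      have := A.adjoint.le_opNorm (m t)
      rw [LinearIsometryEquiv.norm_map] at this
      exact this.trans (by gcongr)
    have p4 : -(C * (‖A‖ * C)) ≤ t * inner ℝ (v t) (A.adjoint (m t)) := by
      rw [← real_inner_smul_left]
      refine (neg_le_neg ?_).trans (neg_le_of_abs_le (abs_real_inner_le_norm _ _))
      gcongr
    simp only [Pi.add_apply, corrector]
    linarith
  · have ht0 : 0 < t := hT.trans_le ht
    have h1 := mul_le_mul_of_nonneg_left (hE t ht) (by positivity : 0 ≤ (M + 1) / δ)
    have h2 := hΦ t ht (z t) (v t) (g t) (m t) (w t)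
    have h3 : (M + 1) / δ *
        -(δ * t * (‖g t‖ ^ 2 + β * ‖A (z t)‖ ^ 2 + ‖v t‖ ^ 2 + ‖w t‖ ^ 2))
        = -((M + 1) * t * (‖g t‖ ^ 2 + β * ‖A (z t)‖ ^ 2 + ‖v t‖ ^ 2 + ‖w t‖ ^ 2)) := by
      field_simp
    have q1 : 0 ≤ t * (β * ‖A (z t)‖ ^ 2) := by positivity
    have q2 : 0 ≤ t * ‖g t‖ ^ 2 := by positivity
    have q3 : 0 ≤ t * ‖v t‖ ^ 2 := by positivity
    have q4 : 0 ≤ t * ‖w t‖ ^ 2 := by positivity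
    linarith

/-- The constraint residual is `O(1 / t²)`: with `y = t • w + (α - 1) • m`, which is bounded, the
dual equation says that `r = y - (θ * t²) • A z` solves `t * r' + k * r = k * y`
for `k = (1 - 2 * θ) / θ`. -/
lemma isBigO_residual (h : CentredFlow A α β θ κ T F z v a g m w c) (hT : 0 < T)
    (hα : 3 < α) (hβ : 0 ≤ β) (hθ₀ : 0 < θ) (hθ : θ < 1 / 2) (hξ : 0 < θ * α - θ - 1)
    (hκ : 0 < κ) : (fun t => ‖A (z t)‖) =O[atTop] (fun t : ℝ => 1 / t ^ 2) := by
  obtain ⟨C, hC⟩ := h.exists_bounds hT hβ hθ₀ hθ hξ hκ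
  have hy : ∀ t ≥ T, ‖t • w t + (α - 1) • m t‖ ≤ C + (α - 1) * C := by
    intro t ht
    obtain ⟨b1, -, b2⟩ := hC t ht
    refine (norm_add_le _ _).trans (add_le_add b2 ?_)
    rw [norm_smul, Real.norm_of_nonneg (by linarith)]
    exact mul_le_mul_of_nonneg_left b1 (by linarith)
  have hr : ∀ t ≥ T, HasDerivAt
      (fun t => t • w t + (α - 1) • m t - (θ * t ^ 2) • A (z t))
      (((1 - 2 * θ) * t) • A (z t)) t := by
    intro t ht
    have hAz : HasDerivAt (fun t => A (z t)) (A (v t)) t :=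
      A.hasFDerivAt.comp_hasDerivAt t (h.hz t ht)
    have hsq : HasDerivAt (fun t : ℝ => θ * t ^ 2) (θ * (2 * t)) t := by
      simpa using (hasDerivAt_pow 2 t).const_mul θ
    have hd := (((hasDerivAt_id t).smul (h.hw t ht)).add ((h.hm t ht).const_smul (α - 1))).sub
      (hsq.smul hAz)
    refine hd.congr_deriv ?_
    have e : t • c t = t • A (z t + (θ * t) • v t) - α • w t :=
      eq_sub_of_add_eq (h.eq_dual t ht)
    simp only [id]
    rw [e, map_add, map_smul]
    module
  obtain ⟨B, hB⟩ := exists_norm_le_of_relaxation (k := (1 - 2 * θ) / θ) hT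
    (div_pos (by linarith) hθ₀) hr (fun t ht => by
      have e : (1 - 2 * θ) / θ * (θ * t ^ 2) = t * ((1 - 2 * θ) * t) := by
        field_simp
      rw [smul_sub, smul_smul ((1 - 2 * θ) / θ) (θ * t ^ 2), e, smul_smul]
      abel) hy
  refine IsBigO.of_bound ((C + (α - 1) * C + B) / θ) ?_
  filter_upwards [eventually_ge_atTop T] with t ht
  have ht0 : 0 < t := hT.trans_le ht
  rw [norm_norm, Real.norm_of_nonneg (by positivity), div_mul_div_comm, mul_one,
    le_div_iff₀ (by positivity)]
  have h1 := norm_sub_le (t • w t + (α - 1) • m t)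
    (t • w t + (α - 1) • m t - (θ * t ^ 2) • A (z t))
  rw [sub_sub_cancel, norm_smul, Real.norm_of_nonneg (by positivity)] at h1
  linarith [hy t ht, hB t ht]

end CentredFlow

end Flow

/-! ### From the primal-dual system to the centred flow -/

section Solution

lemma gradDual_augLagrangian {X Y : Type*} [NormedAddCommGroup X] [InnerProductSpace ℝ X]
    [NormedAddCommGroup Y] [InnerProductSpace ℝ Y] [CompleteSpace Y]
    (f : X → ℝ) (A : X →L[ℝ] Y) (b : Y) (β : ℝ) (x : X) (l : Y) :
    gradDual (augLagrangian f A b β) x l = A x - b := by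
  refine HasGradientAt.gradient ?_
  have h1 := ((((hasFDerivAt_id l).inner ℝ (hasFDerivAt_const (A x - b) l)).const_add
    (f x)).add_const (β / 2 * ‖A x - b‖ ^ 2))
  refine HasFDerivAt.congr_fderiv (f := fun m => augLagrangian f A b β x m) h1 ?_
  ext d
  simp [inner_sub_right, real_inner_comm]

lemma gradDual_lagrangian {X Y : Type*} [NormedAddCommGroup X] [InnerProductSpace ℝ X]
    [NormedAddCommGroup Y] [InnerProductSpace ℝ Y] [CompleteSpace Y]
    (f : X → ℝ) (A : X →L[ℝ] Y) (b : Y) (x : X) (l : Y) :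
    gradDual (lagrangian f A b) x l = A x - b := by
  have h := gradDual_augLagrangian f A b 0 x l
  have e : augLagrangian f A b 0 = lagrangian f A b := by
    funext x l
    simp [augLagrangian]
  rwa [e] at h

lemma apply_eq_of_mem_saddlePoints {X Y : Type*} [NormedAddCommGroup X] [InnerProductSpace ℝ X]
    [NormedAddCommGroup Y] [InnerProductSpace ℝ Y] {f : X → ℝ} {A : X →L[ℝ] Y} {b : Y}
    {xs : X} {ls : Y} (hs : (xs, ls) ∈ saddlePoints f A b) : A xs = b := by
  have h := (hs xs (ls + (A xs - b))).1
  simp only [lagrangian, inner_add_left, real_inner_self_eq_norm_sq] at h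
  have h2 : ‖A xs - b‖ ^ 2 = 0 := le_antisymm (by linarith) (sq_nonneg _)
  exact sub_eq_zero.1 (norm_eq_zero.1 (pow_eq_zero_iff two_ne_zero |>.1 h2))

variable {X Y : Type*}
  [NormedAddCommGroup X] [InnerProductSpace ℝ X] [CompleteSpace X]
  [NormedAddCommGroup Y] [InnerProductSpace ℝ Y] [CompleteSpace Y]

lemma gradPrimal_augLagrangian {f : X → ℝ} (hf : Differentiable ℝ f) (A : X →L[ℝ] Y) (b : Y)
    (β : ℝ) (x : X) (l : Y) :
    gradPrimal (augLagrangian f A b β) x l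
      = gradient f x + A.adjoint l + β • A.adjoint (A x - b) := by
  refine HasGradientAt.gradient ?_
  have hA : HasFDerivAt (fun x => A x - b) A x := A.hasFDerivAt.sub_const b
  have h1 := ((hf x).hasGradientAt.hasFDerivAt.add
    ((hasFDerivAt_const l x).inner ℝ hA)).add (hA.norm_sq.const_mul (β / 2))
  refine HasFDerivAt.congr_fderiv (f := fun z => augLagrangian f A b β z l) h1 ?_
  ext d
  simp [ContinuousLinearMap.adjoint_inner_left]
  ring

lemma gradPrimal_lagrangian {f : X → ℝ} (hf : Differentiable ℝ f) (A : X →L[ℝ] Y) (b : Y)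
    (x : X) (l : Y) :
    gradPrimal (lagrangian f A b) x l = gradient f x + A.adjoint l := by
  have h := gradPrimal_augLagrangian hf A b 0 x l
  have e : augLagrangian f A b 0 = lagrangian f A b := by
    funext x l
    simp [augLagrangian]
  rwa [e, zero_smul, add_zero] at h

lemma gradient_add_adjoint_eq_zero_of_mem_saddlePoints {f : X → ℝ} (hf : Differentiable ℝ f)
    {A : X →L[ℝ] Y} {b : Y} {xs : X} {ls : Y} (hs : (xs, ls) ∈ saddlePoints f A b) :
    gradient f xs + A.adjoint ls = 0 := by
  rw [← gradPrimal_lagrangian hf A b]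
  have hmin : IsLocalMin (fun x => lagrangian f A b x ls) xs :=
    Eventually.of_forall fun x => (hs x ls).2
  rw [gradPrimal, gradient, hmin.fderiv_eq_zero, map_zero]

lemma hasDerivAt_vel {E : Type*} [NormedAddCommGroup E] [NormedSpace ℝ E] {u : ℝ → E}
    {t₀ t : ℝ} (hu : DifferentiableOn ℝ u (Ici t₀)) (ht : t₀ < t) :
    HasDerivAt u (vel t₀ u t) t :=
  (hu t ht.le).hasDerivWithinAt.hasDerivAt (Ici_mem_nhds ht)

lemma differentiableOn_vel {E : Type*} [NormedAddCommGroup E] [NormedSpace ℝ E] {u : ℝ → E}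
    {t₀ : ℝ} (hu : ContDiffOn ℝ 2 u (Ici t₀)) : DifferentiableOn ℝ (vel t₀ u) (Ici t₀) :=
  (hu.derivWithin (m := 1) (uniqueDiffOn_Ici t₀) (by norm_num)).differentiableOn one_ne_zero

/-- A solution of the primal-dual system is a centred flow away from the initial time, where the
derivatives are two-sided. The cocoercivity constant `1 / (2 * (ℓ + 1))` also covers `ℓ = 0`. -/
lemma IsSolution.centredFlow {f : X → ℝ} (hf : ContDiff ℝ 1 f) (hconv : ConvexOn ℝ univ f)
    {ℓ : ℝ≥0} (hlip : LipschitzWith ℓ (gradient f)) {A : X →L[ℝ] Y} {b : Y}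
    {α β θ t₀ : ℝ} (ht₀ : 0 < t₀) {x₀ : X} {l₀ : Y} {v₀ : X} {w₀ : Y} {x : ℝ → X} {l : ℝ → Y}
    (hsol : IsSolution f A b α β θ t₀ x₀ l₀ v₀ w₀ x l)
    {xs : X} {ls : Y} (hs : (xs, ls) ∈ saddlePoints f A b) :
    CentredFlow A α β θ (1 / (2 * ((ℓ : ℝ) + 1))) (t₀ + 1)
      (fun t => f (x t) - f xs - inner ℝ (gradient f xs) (x t - xs))
      (fun t => x t - xs) (vel t₀ x) (vel t₀ (vel t₀ x))
      (fun t => gradient f (x t) - gradient f xs)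
      (fun t => l t - ls) (vel t₀ l) (vel t₀ (vel t₀ l)) := by
  have hfd : Differentiable ℝ f := hf.differentiable one_ne_zero
  have hlt : ∀ {t}, t ≥ t₀ + 1 → t₀ < t := fun ht => (lt_add_one t₀).trans_le ht
  have hx : ∀ t ≥ t₀ + 1, HasDerivAt x (vel t₀ x t) t := fun t ht =>
    hasDerivAt_vel (hsol.contDiffOn_primal.differentiableOn two_ne_zero) (hlt ht)
  have hl : ∀ t ≥ t₀ + 1, HasDerivAt l (vel t₀ l t) t := fun t ht =>
    hasDerivAt_vel (hsol.contDiffOn_dual.differentiableOn two_ne_zero) (hlt ht)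
  have hb := apply_eq_of_mem_saddlePoints hs
  have hstat := gradient_add_adjoint_eq_zero_of_mem_saddlePoints hfd hs
  refine
    { hz := fun t ht => (hx t ht).sub_const xs
      hv := fun t ht => hasDerivAt_vel (differentiableOn_vel hsol.contDiffOn_primal) (hlt ht)
      hm := fun t ht => (hl t ht).sub_const ls
      hw := fun t ht => hasDerivAt_vel (differentiableOn_vel hsol.contDiffOn_dual) (hlt ht)
      hF := fun t ht => ?_
      eq_primal := fun t ht => ?_
      eq_dual := fun t ht => ?_
      F_nonneg := fun t ht => ?_
      cocoercive := fun t ht => ?_ }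
  · have h1 := hasDerivAt_comp_of_hasGradientAt (hfd (x t)).hasGradientAt (hx t ht)
    have h2 := (hasDerivAt_const t (gradient f xs)).inner ℝ ((hx t ht).sub_const xs)
    refine ((h1.sub_const (f xs)).sub h2).congr_deriv ?_
    rw [inner_zero_left, add_zero, inner_sub_left]
  · have ht0 : t ≠ 0 := (ht₀.trans (hlt ht)).ne'
    have h := hsol.eq_primal t (hlt ht).le
    rw [gradPrimal_augLagrangian hfd] at h
    have e : gradient f xs = -A.adjoint ls := eq_neg_of_add_eq_zero_left hstat
    have h2 := congrArg (fun u => t • u) h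
    simp only [smul_add, smul_zero, smul_smul, mul_div_cancel₀ _ ht0] at h2
    rw [← h2, map_sub A (x t) xs, hb, e]
    simp only [map_add, map_sub, map_smul]
    module
  · have ht0 : t ≠ 0 := (ht₀.trans (hlt ht)).ne'
    have h := hsol.eq_dual t (hlt ht).le
    rw [gradDual_augLagrangian] at h
    have h2 := congrArg (fun u => t • u) (sub_eq_zero.1 h)
    simp only [smul_add, smul_smul, mul_div_cancel₀ _ ht0] at h2
    rw [h2, ← hb]
    simp only [map_add, map_sub, map_smul]
    module
  · have := add_inner_gradient_le hfd hconv xs (x t)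
    linarith
  · refine sub_add_norm_sq_gradient_le hfd hconv (by positivity) (fun y y' => ?_) (x t) xs
    refine (hlip.norm_sub_le y y').trans ?_
    gcongr
    linarith

end Solution

end PDAVD

theorem mainTheorem4 {X Y : Type*}
    [NormedAddCommGroup X] [InnerProductSpace ℝ X] [CompleteSpace X]
    [NormedAddCommGroup Y] [InnerProductSpace ℝ Y] [CompleteSpace Y]
    (f : X → ℝ) (hf : ContDiff ℝ 1 f) (hconv : ConvexOn ℝ Set.univ f)
    (ℓ : ℝ≥0) (hlip : LipschitzWith ℓ (gradient f))
    (A : X →L[ℝ] Y) (b : Y)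
    (α β θ t₀ : ℝ) (hα : 3 < α) (hβ : 0 ≤ β) (hθ₁ : 1 / (α - 1) < θ) (hθ₂ : θ < 1 / 2)
    (ht₀ : 0 < t₀)
    (x₀ : X) (l₀ : Y) (v₀ : X) (w₀ : Y) (x : ℝ → X) (l : ℝ → Y)
    (hsol : PDAVD.IsSolution f A b α β θ t₀ x₀ l₀ v₀ w₀ x l)
    (xs : X) (ls : Y) (hs : (xs, ls) ∈ PDAVD.saddlePoints f A b) :
    (fun t : ℝ => ‖A.adjoint (l t - ls)‖) =o[atTop] (fun t : ℝ => 1 / √t) ∧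
    (fun t : ℝ => ‖gradient f (x t) - gradient f xs‖) =o[atTop] (fun t : ℝ => 1 / √t) ∧
    (∀ t ∈ Set.Ici t₀, PDAVD.gradPrimal (PDAVD.lagrangian f A b) (x t) (l t)
      = gradient f (x t) + A.adjoint (l t)) ∧
    (fun t : ℝ => ‖gradient f (x t) + A.adjoint (l t)‖) =o[atTop] (fun t : ℝ => 1 / √t) ∧
    (∀ t ∈ Set.Ici t₀, PDAVD.gradDual (PDAVD.lagrangian f A b) (x t) (l t) = A (x t) - b) ∧
    (fun t : ℝ => ‖A (x t) - b‖) =O[atTop] (fun t : ℝ => 1 / t ^ 2) := by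
  have hfd : Differentiable ℝ f := hf.differentiable one_ne_zero
  have hθ₀ : 0 < θ := lt_trans (by have : 0 < α - 1 := by linarith
                                   positivity) hθ₁
  have hξ : 0 < θ * α - θ - 1 := by
    rw [div_lt_iff₀ (by linarith)] at hθ₁
    linarith
  have hκ : 0 < 1 / (2 * ((ℓ : ℝ) + 1)) := by positivity
  have hT : 0 < t₀ + 1 := by linarith
  have hflow := hsol.centredFlow hf hconv hlip ht₀ hs
  obtain ⟨W, W', B, hW, hB, hdiss⟩ :=
    hflow.exists_dissipated_functional hT hβ hθ₀ hθ₂ hξ hκ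
  have hdual : (fun t : ℝ => ‖A.adjoint (l t - ls)‖) =o[atTop] (fun t : ℝ => 1 / √t) := by
    refine PDAVD.isLittleO_one_div_sqrt_of_dissipation (c := 1 / 4) (by norm_num)
      (norm_nonneg A) hW hB hflow.hm (fun t ht => (hdiss t ht).trans ?_) (fun s _ t _ => ?_)
    · have ht0 : 0 < t := hT.trans_le ht
      have : 0 ≤ t * (‖gradient f (x t) - gradient f xs‖ ^ 2 + ‖PDAVD.vel t₀ x t‖ ^ 2) := by
        positivity
      linarith
    · rw [← map_sub]
      have := A.adjoint.le_opNorm (l s - ls - (l t - ls))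
      rwa [LinearIsometryEquiv.norm_map] at this
  have hprimal : (fun t : ℝ => ‖gradient f (x t) - gradient f xs‖) =o[atTop]
      (fun t : ℝ => 1 / √t) := by
    refine PDAVD.isLittleO_one_div_sqrt_of_dissipation (c := 1 / 4) (by norm_num)
      ℓ.coe_nonneg hW hB hflow.hz (fun t ht => (hdiss t ht).trans ?_) (fun s _ t _ => ?_)
    · have ht0 : 0 < t := hT.trans_le ht
      have : 0 ≤ t * (‖A.adjoint (l t - ls)‖ ^ 2 + ‖PDAVD.vel t₀ l t‖ ^ 2) := by
        positivity
      linarith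
    · rw [sub_sub_sub_cancel_right, sub_sub_sub_cancel_right]
      exact hlip.norm_sub_le _ _
  refine ⟨hdual, hprimal, fun t _ => PDAVD.gradPrimal_lagrangian hfd A b _ _, ?_,
    fun t _ => PDAVD.gradDual_lagrangian f A b _ _, ?_⟩
  · have hstat := PDAVD.gradient_add_adjoint_eq_zero_of_mem_saddlePoints hfd hs
    have e : ∀ t, gradient f (x t) + A.adjoint (l t)
        = (gradient f (x t) - gradient f xs) + A.adjoint (l t - ls) := by
      intro t
      rw [eq_neg_of_add_eq_zero_left hstat, map_sub]
      abel
    simp only [e]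
    exact (hprimal.of_norm_left.add hdual.of_norm_left).norm_left
  · have hres := hflow.isBigO_residual hT hα hβ hθ₀ hθ₂ hξ hκ
    simpa only [map_sub, PDAVD.apply_eq_of_mem_saddlePoints hs] using hres
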